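/- Let $\mathbb K$ be a field. For a finite simple graph $H$, a cut $A\mid B=B\mid A$ is an unordered partition of $V(H)$ into two (possibly empty) parts, and the cut ideal $I_H$ is the kernel of $$\phi_H:\mathbb K[q_{A\mid B}]\to\mathbb K[s_e,t_e : e\in E(H)],\qquad q_{A\mid B}\mapsto\prod_{e\text{ cut by }A\mid B}s_e\prod_{e\text{ not cut by }A\mid B}t_e .$$ Let $\mu(H)$ be the largest degree of a minimal generator of $I_H$, that is, of an element of a minimal homogeneous generating set ($\mu(H)=0$ if $I_H=0$). The height $h_{u,v}(q)$ of a monomial $q=q_{A_1\mid B_1}\cdots q_{A_n\mid B_n}$ is the number of $i$ such that $u,v$ lie in different parts of $A_i\mid B_i$. A binomial generating set of $I_H$ is a set of binomials $q-q'$, with $q,q'$ monic monomials of equal degree, generating $I_H$; it is slow-varying with respect to $u,v$ if $|h_{u,v}(q)-h_{u,v}(q')|\le 2$ for each of its members $q-q'$. Theorem. Let $G$ be a finite simple graph with two distinct non-adjacent vertices $u,v$, and let $L,R\subseteq V(G)$ satisfy $L\cup R=V(G)$, $L\cap R=\{u,v\}$ and $E(G)=E(G[L])\cup E(G[R])$.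 Suppose that there is a path from $u$ to $v$ in $G[L]$ and one in $G[R]$, and that each of $I_{G[L]}$ and $I_{G[R]}$ has a binomial generating set that is slow-varying with respect to $u,v$. Then $$\mu(G)\le\max\{2\mu(G[L])-2,\;2\mu(G[R])-2,\;\mu(G[L]+uv),\;\mu(G[R]+uv)\}.$$ Moreover, let $\mathbf F_L,\mathbf F_R$ be any slow-varying binomial generating sets of $I_{G[L]},I_{G[R]}$ with respect to $u,v$, and let $\mathbf F_{L+uv},\mathbf F_{R+uv}$ be any binomial generating sets of $I_{G[L]+uv},I_{G[R]+uv}$. For a monomial $p=\prod_i q_{C_i\mid D_i}$ of $\mathbb K[q_G]$ and $S\in\{L,R\}$ write $p|_S=\prod_i q_{C_i\cap S\mid D_i\cap S}$. Then $I_G$ is generated by the union of the following four sets of binomials. (i) Lifts of members of $\mathbf F_{L+uv}$: all $\prod_{i}q_{C_i\mid D_i}-\prod_{i}q_{C_i'\mid D_i'}$ whose restriction $\prod_i q_{C_i\cap L\mid D_i\cap L}-\prod_i q_{C'_i\cap L\mid D'_i\cap L}$ is in $\mathbf F_{L+uv}$ and whose factors can be numbered so that, for every $i$, the two cuts $C_i\mid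 D_i$ and $C_i'\mid D_i'$ induce the same cut of $R$. (ii) Lifts of members of $\mathbf F_{R+uv}$, defined in the same way with $L$ and $R$ exchanged. (iii) Joins of $\pm(q_1-q_2)\in\mathbf F_L$ and $\pm(q_3-q_4)\in\mathbf F_R$ with $|h_{u,v}(q_1)-h_{u,v}(q_2)|=|h_{u,v}(q_3)-h_{u,v}(q_4)|=2$: all $p_1-p_2$ with $p_1|_L=r\,q_1$, $p_2|_L=r\,q_2$, $p_1|_R=r'q_3$, $p_2|_R=r'q_4$ for some monomials $r,r'$, and $\deg p_1\le\deg q_1+\deg q_3-2$. (iv) Quadratic reordering binomials: all $q_{c_1}q_{c_2}-q_{c_1'}q_{c_2'}$ for cuts $c_1,c_2,c_1',c_2'$ of $G$ with $c_1|_L=c_1'|_L$, $c_2|_L=c_2'|_L$, $c_1|_R=c_2'|_R$, $c_2|_R=c_1'|_R$. -/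

import Mathlib

/-- Two vertex sets `A` and `B` describe the same cut iff `B = A` or `B` is the complement of `A`. -/
def cutSetoid (V : Type*) : Setoid (Set V) where
  r A B := A = B ∨ A = Bᶜ
  iseqv :=
    { refl := fun _ => Or.inl rfl
      symm := by
        rintro A B (h | h)
        · exact Or.inl h.symm
        · exact Or.inr (by rw [h, compl_compl])
      trans := by
        rintro A B C (h | h) (h' | h')
        · exact Or.inl (h.trans h')
        · exact Or.inr (h.trans h')
        · exact Or.inr (by rw [h, h'])
        · exact Or.inl (by rw [h, h', compl_compl]) }

/-- The cuts `A ∣ B = B ∣ A` of a vertex set: unordered partitions into two (possibly empty) parts.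
The cut `A ∣ Aᶜ` is the class of `A`. -/
def Cut (V : Type*) : Type _ := Quotient (cutSetoid V)

namespace Cut

variable {V : Type*}

/-- The cut `A ∣ Aᶜ`. -/
def mk (A : Set V) : Cut V := Quotient.mk (cutSetoid V) A

/-- `a` and `b` lie in different parts of the cut. -/
def Separates (c : Cut V) (a b : V) : Prop :=
  Quotient.lift (fun A : Set V => ¬ (a ∈ A ↔ b ∈ A))
    (by
      rintro A B (h | h)
      · rw [h]
      · subst h
        simp only [Set.mem_compl_iff, not_iff_not]) c

/-- The cut `A ∩ S ∣ B ∩ S` of `S` induced by the cut `A ∣ B`. -/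
def restrict (S : Set V) (c : Cut V) : Cut S :=
  Quotient.map' (s₁ := cutSetoid V) (s₂ := cutSetoid S) (fun A : Set V => (Subtype.val ⁻¹' A : Set S))
    (by
      rintro A B (h | h)
      · exact Or.inl (by rw [h])
      · exact Or.inr (by rw [h, Set.preimage_compl])) c

end Cut

section CutIdeal

open MvPolynomial

variable {V : Type*}

open Classical in
/-- The homomorphism `φ_G : K[q] → K[s, t]`. The variables of `K[q]` are the cuts; the variables
of `K[s, t]` are `s_e = X (Sum.inl e)` and `t_e = X (Sum.inr e)` for the edges `e` of `G`. -/
noncomputable def cutMap (K : Type*) [Field K] (G : SimpleGraph V) :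
    MvPolynomial (Cut V) K →ₐ[K] MvPolynomial (G.edgeSet ⊕ G.edgeSet) K :=
  aeval fun c : Cut V => ∏ᶠ e : G.edgeSet,
    if ∃ a ∈ (e : Sym2 V), ∃ b ∈ (e : Sym2 V), c.Separates a b then X (Sum.inl e)
    else X (Sum.inr e)

/-- The cut ideal `I_G`. -/
noncomputable def cutIdeal (K : Type*) [Field K] (G : SimpleGraph V) :
    Ideal (MvPolynomial (Cut V) K) :=
  RingHom.ker (cutMap K G)

/-- `S` is a minimal set of homogeneous generators of the ideal `I`. -/
def IsMinimalGeneratingSet {σ K : Type*} [Field K] (I : Ideal (MvPolynomial σ K))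
    (S : Set (MvPolynomial σ K)) : Prop :=
  (∀ f ∈ S, ∃ d, f.IsHomogeneous d) ∧ Ideal.span S = I ∧ ∀ T, T ⊂ S → Ideal.span T ≠ I

/-- `μ(G)`: the largest degree of a minimal generator of `I_G` (and `0` if `I_G = 0`). -/
noncomputable def cutMu (K : Type*) [Field K] (G : SimpleGraph V) : ℕ :=
  sSup {d | ∃ S, IsMinimalGeneratingSet (cutIdeal K G) S ∧ ∃ f ∈ S, f.totalDegree = d}

/-- The monomial `q_{A₁∣B₁} ⋯ q_{Aₙ∣Bₙ}` of a list (up to order) of cuts. -/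
noncomputable def cutMonomial (K : Type*) [Field K] (m : Multiset (Cut V)) :
    MvPolynomial (Cut V) K :=
  (m.map X).prod

/-- The binomial `q - q'` given by a pair of lists of cuts. -/
noncomputable def cutBinomial (K : Type*) [Field K] (p : Multiset (Cut V) × Multiset (Cut V)) :
    MvPolynomial (Cut V) K :=
  cutMonomial K p.1 - cutMonomial K p.2

open Classical in
/-- The height `h_{u,v}`: the number of cuts in the list with `u` and `v` in different parts. -/
noncomputable def height (u v : V) (m : Multiset (Cut V)) : ℕ :=
  m.countP fun c => c.Separates u v

/-- `F` is a set of binomials `q - q'`, with `q` and `q'` products of equally many variables,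
that generates `I_G`. -/
def IsBinomialGeneratingSet (K : Type*) [Field K] (G : SimpleGraph V)
    (F : Set (Multiset (Cut V) × Multiset (Cut V))) : Prop :=
  (∀ p ∈ F, Multiset.card p.1 = Multiset.card p.2) ∧
    Ideal.span (cutBinomial K '' F) = cutIdeal K G

/-- `F` is a slow-varying set of generators of `I_G` with respect to `u` and `v`. -/
def IsSlowVarying (K : Type*) [Field K] (G : SimpleGraph V) (u v : V)
    (F : Set (Multiset (Cut V) × Multiset (Cut V))) : Prop :=
  IsBinomialGeneratingSet K G F ∧
    ∀ p ∈ F, |(height u v p.1 : ℤ) - (height u v p.2 : ℤ)| ≤ 2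

/-- Lifts of the binomials in `F` from the side `S` to `V`, where `T` is the other side: the
binomials `∏ q_{Cᵢ∣Dᵢ} - ∏ q_{Cᵢ'∣Dᵢ'}` that restrict on `S` to a member of `F` and whose factors
can be numbered so that `Cᵢ∣Dᵢ` and `Cᵢ'∣Dᵢ'` agree on `T` for every `i`. -/
def lifts (S T : Set V) (F : Set (Multiset (Cut S) × Multiset (Cut S))) :
    Set (Multiset (Cut V) × Multiset (Cut V)) :=
  {p | (p.1.map (Cut.restrict S), p.2.map (Cut.restrict S)) ∈ F ∧
    p.1.map (Cut.restrict T) = p.2.map (Cut.restrict T)}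

/-- Joins of height-changing binomials from the two sides: the binomials `p₁ - p₂` that restrict
to `r (q₁ - q₂)` on `L` and to `r' (q₃ - q₄)` on `R` for monomials `r, r'`, where, up to sign,
`q₁ - q₂` is in `FL`, `q₃ - q₄` is in `FR`, both change the height by exactly two, and
`deg p₁ ≤ deg q₁ + deg q₃ - 2`. -/
def joins (L R : Set V) (uL vL : L) (uR vR : R)
    (FL : Set (Multiset (Cut L) × Multiset (Cut L)))
    (FR : Set (Multiset (Cut R) × Multiset (Cut R))) :
    Set (Multiset (Cut V) × Multiset (Cut V)) :=
  {p | ∃ (q₁ q₂ r : Multiset (Cut L)) (q₃ q₄ r' : Multiset (Cut R)),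
    ((q₁, q₂) ∈ FL ∨ (q₂, q₁) ∈ FL) ∧ ((q₃, q₄) ∈ FR ∨ (q₄, q₃) ∈ FR) ∧
    |(height uL vL q₁ : ℤ) - (height uL vL q₂ : ℤ)| = 2 ∧
    |(height uR vR q₃ : ℤ) - (height uR vR q₄ : ℤ)| = 2 ∧
    p.1.map (Cut.restrict L) = r + q₁ ∧ p.2.map (Cut.restrict L) = r + q₂ ∧
    p.1.map (Cut.restrict R) = r' + q₃ ∧ p.2.map (Cut.restrict R) = r' + q₄ ∧
    Multiset.card p.1 + 2 ≤ Multiset.card q₁ + Multiset.card q₃}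

/-- The quadratic reordering binomials `q_{c₁} q_{c₂} - q_{c₁'} q_{c₂'}`: the two cuts keep their
restrictions to `L` and exchange their restrictions to `R`. -/
def reorderings (L R : Set V) : Set (Multiset (Cut V) × Multiset (Cut V)) :=
  {p | ∃ c₁ c₂ c₁' c₂' : Cut V, p = ({c₁, c₂}, {c₁', c₂'}) ∧
    c₁.restrict L = c₁'.restrict L ∧ c₂.restrict L = c₂'.restrict L ∧
    c₁.restrict R = c₂'.restrict R ∧ c₂.restrict R = c₁'.restrict R}

end CutIdeal

/-! A binomial q - q' lies in the ideal generated by a set `F` of binomials exactly when exchanges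
from `F` lead from q to q' (`cutBinomial_mem_span_iff`). If G has an edge, q - q' lies in I_G
exactly when q and q' have equal degree and equal height at every edge
(`cutBinomial_mem_cutIdeal_iff`). So the task is to connect multisets of cuts. A cut of G is a pair
of cuts of L and R that agree on whether they separate u and v; up to reorderings, a monomial is a
pair of monomials of equal degree and equal uv-height.

If two monomials of I_G-equal class have the same uv-height, their restrictions are congruent modulo
the ideals of G[L]+uv and G[R]+uv, whose binomials preserve that height and hence lift
(`IsTwoSeparation.linked_of_linked`). If the heights differ, they differ by an even number, because
u and v are connected. Slow variation then yields on each side an exchange that starts at the lower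
height and raises it by two (`Linked.exists_step_height_add_two`). Performed together, the two
exchanges are a monomial multiple of a join (`IsTwoSeparation.exists_linked_joins`), and repetition
reaches the target height (`linked_of_height_le`).

The bound on μ(G) follows by taking generating sets of degree at most μ on the pieces;
`two_le_cutMu` absorbs the quadratic reorderings. -/

section Linked

/-! ### Exchange moves on multisets -/

variable {α : Type*}

/-- `y` arises from `x` by exchanging the two sides of a member of `F`. -/
def Step (F : Set (Multiset α × Multiset α)) (x y : Multiset α) : Prop :=
  ∃ r q q', ((q, q') ∈ F ∨ (q', q) ∈ F) ∧ x = r + q ∧ y = r + q'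

/-- `x` and `y` are connected by steps of `F`. -/
def Linked (F : Set (Multiset α × Multiset α)) : Multiset α → Multiset α → Prop :=
  Relation.ReflTransGen (Step F)

variable {F : Set (Multiset α × Multiset α)}

theorem Step.symm {x y : Multiset α} (h : Step F x y) : Step F y x := by
  obtain ⟨r, q, q', h, hx, hy⟩ := h
  exact ⟨r, q', q, h.symm, hy, hx⟩

theorem Step.add_left {x y : Multiset α} (z : Multiset α) (h : Step F x y) :
    Step F (z + x) (z + y) := by
  obtain ⟨r, q, q', h, rfl, rfl⟩ := h
  exact ⟨z + r, q, q', h, (add_assoc _ _ _).symm, (add_assoc _ _ _).symm⟩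

theorem Linked.symm {x y : Multiset α} (h : Linked F x y) : Linked F y x := by
  induction h with
  | refl => exact .refl
  | tail _ h ih => exact ih.head h.symm

theorem Linked.add_left {x y : Multiset α} (z : Multiset α) (h : Linked F x y) :
    Linked F (z + x) (z + y) := by
  induction h with
  | refl => exact .refl
  | tail _ h ih => exact ih.tail (h.add_left z)

theorem Linked.of_mem {x y : Multiset α} (h : (x, y) ∈ F) : Linked F x y :=
  .single ⟨0, x, y, Or.inl h, by simp, by simp⟩

/-- The congruence of multisets connected by steps of `F`. -/
def linkedCon (F : Set (Multiset α × Multiset α)) : AddCon (Multiset α) where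
  r := Linked F
  iseqv := ⟨fun _ => .refl, Linked.symm, Relation.ReflTransGen.trans⟩
  add' := by
    intro w x y z h h'
    refine (h'.add_left w).trans ?_
    rw [add_comm w z, add_comm x z]
    exact h.add_left z

/-- A function that is constant along the members of `F`, up to a common summand, is constant on
connected multisets. -/
theorem Linked.preserves {β : Type*} [AddCommMonoid β] (f : Multiset α →+ β)
    (hF : ∀ p ∈ F, f p.1 = f p.2) {x y : Multiset α} (h : Linked F x y) : f x = f y := by
  induction h with
  | refl => rfl
  | tail _ h ih =>
    obtain ⟨r, q, q', h, rfl, rfl⟩ := h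
    rw [ih, map_add, map_add]
    rcases h with h | h
    · rw [hF _ h]
    · rw [hF _ h]

end Linked

/-! ### Binomial ideals as congruences -/

section Toric

open MvPolynomial

variable {W : Type*} (K : Type*) [Field K]

theorem cutMonomial_add (m m' : Multiset (Cut W)) :
    cutMonomial K (m + m') = cutMonomial K m * cutMonomial K m' := by
  simp [cutMonomial]

open Classical in
theorem cutMonomial_eq_monomial (m : Multiset (Cut W)) :
    cutMonomial K m = monomial (Multiset.toFinsupp m) 1 := by
  induction m using Multiset.induction_on with
  | empty => simp [cutMonomial]
  | cons c m ih =>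
    rw [← Multiset.singleton_add, cutMonomial_add, ih, map_add, Multiset.toFinsupp_singleton,
      ← one_mul (1 : K), ← monomial_mul, one_mul]
    simp [cutMonomial, X]

theorem cutMonomial_isHomogeneous (m : Multiset (Cut W)) :
    (cutMonomial K m).IsHomogeneous (Multiset.card m) := by
  classical
  induction m using Multiset.induction_on with
  | empty => simpa [cutMonomial] using isHomogeneous_one (Cut W) K
  | cons c m ih =>
    rw [← Multiset.singleton_add, cutMonomial_add, Multiset.card_add, Multiset.card_singleton]
    refine IsHomogeneous.mul ?_ ih
    simpa [cutMonomial] using isHomogeneous_X K c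

theorem cutBinomial_isHomogeneous {p : Multiset (Cut W) × Multiset (Cut W)}
    (h : Multiset.card p.1 = Multiset.card p.2) :
    (cutBinomial K p).IsHomogeneous (Multiset.card p.1) :=
  (cutMonomial_isHomogeneous K p.1).sub (h ▸ cutMonomial_isHomogeneous K p.2)

/-- Sending each monomial to its class in the monoid algebra of the quotient by `linkedCon F` kills
`F`, while distinct classes stay distinct basis elements. Conversely, the binomials along a chain of
steps telescope. -/
theorem cutBinomial_mem_span_iff {F : Set (Multiset (Cut W) × Multiset (Cut W))}
    {m m' : Multiset (Cut W)} :
    cutBinomial K (m, m') ∈ Ideal.span (cutBinomial K '' F) ↔ Linked F m m' := by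
  constructor
  · intro h
    let Ψ : MvPolynomial (Cut W) K →ₐ[K] AddMonoidAlgebra K (linkedCon F).Quotient :=
      aeval fun c => AddMonoidAlgebra.single (({c} : Multiset (Cut W)) : (linkedCon F).Quotient) 1
    have hΨ : ∀ m, Ψ (cutMonomial K m) =
        AddMonoidAlgebra.single (m : (linkedCon F).Quotient) (1 : K) := by
      intro m
      induction m using Multiset.induction_on with
      | empty =>
        simp only [cutMonomial, Multiset.map_zero, Multiset.prod_zero, map_one]
        rfl
      | cons c m ih =>
        rw [← Multiset.singleton_add, cutMonomial_add, map_mul, ih]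
        simp [cutMonomial, Ψ, AddMonoidAlgebra.single_mul_single, ← AddCon.coe_add]
    have hle : Ideal.span (cutBinomial K '' F) ≤ RingHom.ker Ψ := by
      rw [Ideal.span_le]
      rintro _ ⟨⟨q, q'⟩, hq, rfl⟩
      have : (q : (linkedCon F).Quotient) = q' := (AddCon.eq _).2 (Linked.of_mem hq)
      simp [cutBinomial, RingHom.mem_ker, hΨ, this]
    have h1 := hle h
    rw [RingHom.mem_ker, cutBinomial, map_sub, hΨ, hΨ, sub_eq_zero] at h1
    have h2 : (m : (linkedCon F).Quotient) = m' := by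
      by_contra hne
      have := congrArg (fun f => f.coeff (m : (linkedCon F).Quotient)) h1
      simp [Ne.symm hne] at this
    exact (AddCon.eq _).1 h2
  · intro h
    induction h with
    | refl => simp [cutBinomial]
    | @tail x y _ h ih =>
      have hxy : cutBinomial K (m, y) = cutBinomial K (m, x) + cutBinomial K (x, y) := by
        simp [cutBinomial]
      rw [hxy]
      refine Ideal.add_mem _ ih ?_
      obtain ⟨r, q, q', h, rfl, rfl⟩ := h
      have h1 : cutBinomial K (r + q, r + q') = cutMonomial K r * cutBinomial K (q, q') := by
        simp [cutBinomial, cutMonomial_add, mul_sub]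
      rw [h1]
      refine Ideal.mul_mem_left _ _ ?_
      rcases h with h | h
      · exact Ideal.subset_span ⟨_, h, rfl⟩
      · have h2 : cutBinomial K (q, q') = - cutBinomial K (q', q) := by simp [cutBinomial]
        rw [h2]
        exact neg_mem (Ideal.subset_span ⟨_, h, rfl⟩)

theorem exists_cutMap_cutMonomial_eq (G : SimpleGraph W) (m : Multiset (Cut W)) :
    ∃ a, cutMap K G (cutMonomial K m) = monomial a 1 := by
  classical
  have key : ∀ x y : MvPolynomial (G.edgeSet ⊕ G.edgeSet) K,
      (∃ a, x = monomial a 1) → (∃ a, y = monomial a 1) → ∃ a, x * y = monomial a 1 := by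
    rintro _ _ ⟨a, rfl⟩ ⟨b, rfl⟩
    exact ⟨a + b, by simp [monomial_mul]⟩
  induction m using Multiset.induction_on with
  | empty => exact ⟨0, by simp [cutMonomial]⟩
  | cons c m ih =>
    rw [← Multiset.singleton_add, cutMonomial_add, map_mul]
    refine key _ _ ?_ ih
    simp only [cutMonomial, Multiset.map_singleton, Multiset.prod_singleton, cutMap, aeval_X]
    refine finprod_induction (fun x => ∃ a, x = monomial a 1) ⟨0, rfl⟩ key fun e => ?_
    split_ifs
    · exact ⟨Finsupp.single (Sum.inl e) 1, rfl⟩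
    · exact ⟨Finsupp.single (Sum.inr e) 1, rfl⟩

/-- A cut ideal is generated by the binomials it contains. -/
theorem cutIdeal_le_span (G : SimpleGraph W) {F : Set (Multiset (Cut W) × Multiset (Cut W))}
    (hF : ∀ m m', cutMap K G (cutMonomial K m) = cutMap K G (cutMonomial K m') →
      Linked F m m') :
    cutIdeal K G ≤ Ideal.span (cutBinomial K '' F) := by
  classical
  intro f hf
  set J := Ideal.span (cutBinomial K '' F)
  -- A linear map through which the quotient map factors: a monomial in the image goes to the class
  -- of a chosen preimage, which `hF` makes independent of the choice. The value 0 elsewhere plays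
  -- no role. Hence the kernel of `cutMap K G` lies in `J`.
  let s : MvPolynomial (G.edgeSet ⊕ G.edgeSet) K →ₗ[K] MvPolynomial (Cut W) K ⧸ J :=
    (basisMonomials _ K).constr K fun a =>
      if h : ∃ m, cutMap K G (cutMonomial K m) = monomial a 1 then
        Ideal.Quotient.mkₐ K J (cutMonomial K h.choose) else 0
  have hs : s ∘ₗ (cutMap K G).toLinearMap = (Ideal.Quotient.mkₐ K J).toLinearMap := by
    refine (basisMonomials _ K).ext fun d => ?_
    obtain ⟨m, rfl⟩ : ∃ m, Multiset.toFinsupp m = d :=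
      ⟨_, Finsupp.toMultiset_toFinsupp d⟩
    obtain ⟨a, ha⟩ := exists_cutMap_cutMonomial_eq K G m
    have h : ∃ m, cutMap K G (cutMonomial K m) = monomial a 1 := ⟨m, ha⟩
    have hsa : s (monomial a 1) = Ideal.Quotient.mkₐ K J (cutMonomial K h.choose) := by
      have := (basisMonomials (G.edgeSet ⊕ G.edgeSet) K).constr_basis K (fun a =>
        if h : ∃ m, cutMap K G (cutMonomial K m) = monomial a 1 then
        Ideal.Quotient.mkₐ K J (cutMonomial K h.choose) else 0) a
      rw [dif_pos h] at this
      rw [← this, coe_basisMonomials]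
    have hm := cutMonomial_eq_monomial K m
    simp only [coe_basisMonomials, LinearMap.comp_apply, AlgHom.toLinearMap_apply]
    rw [← hm, ha, hsa]
    exact (Ideal.Quotient.mk_eq_mk_iff_sub_mem _ _).2
      ((cutBinomial_mem_span_iff K).2 (hF _ _ (h.choose_spec.trans ha.symm)))
  have h1 := LinearMap.congr_fun hs f
  have h2 : cutMap K G f = 0 := hf
  simp only [LinearMap.comp_apply, AlgHom.toLinearMap_apply, h2, map_zero] at h1
  exact Ideal.Quotient.eq_zero_iff_mem.1 h1.symm

end Toric

/-! ### Cut ideals in terms of edge heights -/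

section EdgeHeights

open MvPolynomial

variable {W : Type*}

/-- `m` and `m'` have the same number of members and the same height at every edge. -/
def EdgeEq (G : SimpleGraph W) (m m' : Multiset (Cut W)) : Prop :=
  Multiset.card m = Multiset.card m' ∧ ∀ a b, G.Adj a b → height a b m = height a b m'

theorem EdgeEq.symm {G : SimpleGraph W} {m m' : Multiset (Cut W)} (h : EdgeEq G m m') :
    EdgeEq G m' m :=
  ⟨h.1.symm, fun a b hab => (h.2 a b hab).symm⟩

theorem EdgeEq.trans {G : SimpleGraph W} {m m' m'' : Multiset (Cut W)} (h : EdgeEq G m m')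
    (h' : EdgeEq G m' m'') : EdgeEq G m m'' :=
  ⟨h.1.trans h'.1, fun a b hab => (h.2 a b hab).trans (h'.2 a b hab)⟩

theorem Cut.separates_mk (A : Set W) (a b : W) :
    (Cut.mk A).Separates a b ↔ ¬ (a ∈ A ↔ b ∈ A) := Iff.rfl

theorem Cut.exists_mk (c : Cut W) : ∃ A, Cut.mk A = c := Quotient.exists_rep c

theorem Cut.mk_compl (A : Set W) : Cut.mk Aᶜ = Cut.mk A := Quotient.sound (Or.inr rfl)

/-- A representative of a cut may be chosen to contain a given vertex. -/
theorem Cut.exists_mk_mem (c : Cut W) (a : W) : ∃ A, a ∈ A ∧ Cut.mk A = c := by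
  obtain ⟨A, rfl⟩ := c.exists_mk
  by_cases h : a ∈ A
  · exact ⟨A, h, rfl⟩
  · exact ⟨Aᶜ, h, Cut.mk_compl A⟩

theorem Cut.separates_comm (c : Cut W) (a b : W) : c.Separates a b ↔ c.Separates b a := by
  obtain ⟨A, rfl⟩ := c.exists_mk
  simp only [Cut.separates_mk]
  tauto

theorem Cut.not_separates_self (c : Cut W) (a : W) : ¬ c.Separates a a := by
  obtain ⟨A, rfl⟩ := c.exists_mk
  simp [Cut.separates_mk]

theorem Cut.separates_iff_xor (c : Cut W) (a b d : W) :
    c.Separates a d ↔ ¬ (c.Separates a b ↔ c.Separates b d) := by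
  obtain ⟨A, rfl⟩ := c.exists_mk
  simp only [Cut.separates_mk]
  tauto

open Classical in
theorem height_add (a b : W) (m m' : Multiset (Cut W)) :
    height a b (m + m') = height a b m + height a b m' :=
  Multiset.countP_add _ _ _

open Classical in
theorem height_zero (a b : W) : height a b 0 = 0 := Multiset.countP_zero _

open Classical in
theorem height_cons (a b : W) (c : Cut W) (m : Multiset (Cut W)) :
    height a b (c ::ₘ m) = height a b m + if c.Separates a b then 1 else 0 :=
  Multiset.countP_cons _ _ _

open Classical in
theorem height_le_card (a b : W) (m : Multiset (Cut W)) : height a b m ≤ Multiset.card m :=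
  Multiset.countP_le_card _ _

open Classical in
theorem height_comm (a b : W) (m : Multiset (Cut W)) : height a b m = height b a m := by
  unfold height
  exact Multiset.countP_congr rfl fun c _ => propext (c.separates_comm a b)

open Classical in
theorem height_parity (a b d : W) (m : Multiset (Cut W)) :
    height a d m % 2 = (height a b m + height b d m) % 2 := by
  induction m using Multiset.induction_on with
  | empty => simp [height_zero]
  | cons c m ih =>
    simp only [height_cons]
    have := c.separates_iff_xor a b d
    by_cases h1 : c.Separates a b <;> by_cases h2 : c.Separates b d <;>
      simp only [h1, h2, iff_true, iff_false, not_true, not_false_iff] at this <;>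
      simp only [h1, h2, this, if_true, if_false] <;> omega

open Classical in
/-- Between connected vertices, the parity of the height is determined by the edge heights. -/
theorem EdgeEq.height_mod_two {G : SimpleGraph W} {a b : W} (hab : G.Reachable a b)
    {m m' : Multiset (Cut W)} (h : EdgeEq G m m') : height a b m % 2 = height a b m' % 2 := by
  obtain ⟨w⟩ := hab
  induction w with
  | nil =>
    have h0 : ∀ (x : W) (m : Multiset (Cut W)), height x x m = 0 := fun x m =>
      Multiset.countP_eq_zero.2 fun c _ => c.not_separates_self x
    rw [h0, h0]
  | @cons x y z hxy _ ih =>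
    rw [height_parity x y z, height_parity x y z m', h.2 _ _ hxy]
    omega

open Classical in
theorem height_map_restrict (S : Set W) (a b : S) (m : Multiset (Cut W)) :
    height a b (m.map (Cut.restrict S)) = height (a : W) b m := by
  unfold height
  rw [Multiset.countP_map, Multiset.countP_eq_card_filter]
  congr 1
  refine Multiset.filter_congr fun c _ => ?_
  obtain ⟨A, rfl⟩ := c.exists_mk
  exact Iff.rfl

variable (K : Type*) [Field K]

theorem cut_condition_iff (c : Cut W) (a b : W) :
    (∃ x ∈ s(a, b), ∃ y ∈ s(a, b), c.Separates x y) ↔ c.Separates a b := by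
  have h1 := c.not_separates_self a
  have h2 := c.not_separates_self b
  have h3 := c.separates_comm a b
  simp only [Sym2.mem_iff]
  constructor
  · rintro ⟨x, rfl | rfl, y, rfl | rfl, h⟩ <;> tauto
  · exact fun h => ⟨a, Or.inl rfl, b, Or.inr rfl, h⟩

theorem cutMap_cutMonomial [Finite W] (G : SimpleGraph W) (m : Multiset (Cut W)) :
    cutMap K G (cutMonomial K m) = ∏ᶠ e : G.edgeSet,
      (X (Sum.inl e) ^ height (e : Sym2 W).out.1 (e : Sym2 W).out.2 m *
        X (Sum.inr e) ^
          (Multiset.card m - height (e : Sym2 W).out.1 (e : Sym2 W).out.2 m)) := by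
  classical
  have : Finite G.edgeSet := inferInstance
  have := Fintype.ofFinite G.edgeSet
  rw [finprod_eq_prod_of_fintype]
  induction m using Multiset.induction_on with
  | empty => simp [cutMonomial, height_zero]
  | cons c m ih =>
    rw [← Multiset.singleton_add, cutMonomial_add, map_mul, ih]
    simp only [cutMonomial, Multiset.map_singleton, Multiset.prod_singleton, cutMap, aeval_X]
    rw [finprod_eq_prod_of_fintype, ← Finset.prod_mul_distrib]
    refine Finset.prod_congr rfl fun e _ => ?_
    have he : (e : Sym2 W) = s((e : Sym2 W).out.1, (e : Sym2 W).out.2) :=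
      (Quot.out_eq (e : Sym2 W)).symm
    have hc : (∃ x ∈ (e : Sym2 W), ∃ y ∈ (e : Sym2 W), c.Separates x y) ↔
        c.Separates (e : Sym2 W).out.1 (e : Sym2 W).out.2 := by
      conv_lhs => rw [he]
      exact cut_condition_iff c _ _
    have hle := height_le_card (e : Sym2 W).out.1 (e : Sym2 W).out.2 m
    rw [Multiset.singleton_add, height_cons, Multiset.card_cons]
    by_cases h : c.Separates (e : Sym2 W).out.1 (e : Sym2 W).out.2
    · rw [if_pos (hc.2 h), if_pos h, Nat.add_sub_add_right, pow_succ]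
      ring
    · rw [if_neg (fun h' => h (hc.1 h')), if_neg h, add_zero, Nat.sub_add_comm hle, pow_succ]
      ring

theorem cutMap_eq_of_edgeEq [Finite W] {G : SimpleGraph W} {m m' : Multiset (Cut W)}
    (h : EdgeEq G m m') :
    cutMap K G (cutMonomial K m) = cutMap K G (cutMonomial K m') := by
  rw [cutMap_cutMonomial, cutMap_cutMonomial]
  refine finprod_congr fun e => ?_
  have he : G.Adj (e : Sym2 W).out.1 (e : Sym2 W).out.2 := by
    rw [← SimpleGraph.mem_edgeSet]
    have : s((e : Sym2 W).out.1, (e : Sym2 W).out.2) = e := Quot.out_eq (e : Sym2 W)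
    rw [this]
    exact e.2
  rw [h.1, h.2 _ _ he]

/-- The exponents of s_e and t_e are the height at e and its complement in the degree. An edge is
needed to recover the degree: without one, every monomial maps to 1. -/
theorem edgeEq_of_cutMap_eq [Finite W] {G : SimpleGraph W} (hG : ∃ a b, G.Adj a b)
    {m m' : Multiset (Cut W)}
    (h : cutMap K G (cutMonomial K m) = cutMap K G (cutMonomial K m')) : EdgeEq G m m' := by
  classical
  have : Finite G.edgeSet := inferInstance
  have := Fintype.ofFinite G.edgeSet
  rw [cutMap_cutMonomial, cutMap_cutMonomial] at h
  simp only [finprod_eq_prod_of_fintype] at h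
  have key : ∀ e : G.edgeSet,
      height (e : Sym2 W).out.1 (e : Sym2 W).out.2 m =
        height (e : Sym2 W).out.1 (e : Sym2 W).out.2 m' ∧
      Multiset.card m - height (e : Sym2 W).out.1 (e : Sym2 W).out.2 m =
        Multiset.card m' - height (e : Sym2 W).out.1 (e : Sym2 W).out.2 m' := by
    intro e
    constructor
    -- Setting all variables but one to 1 and taking the degree reads off a single exponent.
    · have h1 := congrArg (aeval fun i => if i = Sum.inl e then (Polynomial.X : Polynomial K)
        else 1) h
      simp only [map_prod, map_mul, map_pow, aeval_X, Sum.inl.injEq, reduceCtorEq, if_false,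
        one_pow, mul_one] at h1
      simp only [ite_pow, one_pow, Finset.prod_ite_eq', Finset.mem_univ, if_true] at h1
      simpa using congrArg Polynomial.natDegree h1
    · have h1 := congrArg (aeval fun i => if i = Sum.inr e then (Polynomial.X : Polynomial K)
        else 1) h
      simp only [map_prod, map_mul, map_pow, aeval_X, Sum.inr.injEq, reduceCtorEq, if_false,
        one_pow, one_mul] at h1
      simp only [ite_pow, one_pow, Finset.prod_ite_eq', Finset.mem_univ, if_true] at h1
      simpa using congrArg Polynomial.natDegree h1
  have hh : ∀ a b, G.Adj a b → height a b m = height a b m' ∧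
      Multiset.card m - height a b m = Multiset.card m' - height a b m' := by
    intro a b hab
    have h1 := key ⟨s(a, b), hab⟩
    have h2 : s((s(a, b) : Sym2 W).out.1, (s(a, b) : Sym2 W).out.2) = s(a, b) :=
      Quot.out_eq (s(a, b) : Sym2 W)
    rw [Sym2.eq_iff] at h2
    rcases h2 with ⟨h2, h3⟩ | ⟨h2, h3⟩
    · simpa only [h2, h3] using h1
    · simpa only [h2, h3, height_comm b a] using h1
  refine ⟨?_, fun a b hab => (hh a b hab).1⟩
  obtain ⟨a, b, hab⟩ := hG
  have h1 := hh a b hab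
  have h2 := height_le_card a b m
  have h3 := height_le_card a b m'
  omega

theorem cutBinomial_mem_cutIdeal_iff [Finite W] {G : SimpleGraph W} (hG : ∃ a b, G.Adj a b)
    {p : Multiset (Cut W) × Multiset (Cut W)} :
    cutBinomial K p ∈ cutIdeal K G ↔ EdgeEq G p.1 p.2 := by
  rw [cutIdeal, RingHom.mem_ker, cutBinomial, map_sub, sub_eq_zero]
  exact ⟨edgeEq_of_cutMap_eq K hG, cutMap_eq_of_edgeEq K⟩

theorem IsBinomialGeneratingSet.linked_iff [Finite W] {G : SimpleGraph W}
    (hG : ∃ a b, G.Adj a b) {F : Set (Multiset (Cut W) × Multiset (Cut W))}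
    (hF : IsBinomialGeneratingSet K G F) {m m' : Multiset (Cut W)} :
    Linked F m m' ↔ EdgeEq G m m' := by
  rw [← cutBinomial_mem_span_iff K, hF.2, cutBinomial_mem_cutIdeal_iff K hG]

theorem isBinomialGeneratingSet_of_linked [Finite W] {G : SimpleGraph W}
    (hG : ∃ a b, G.Adj a b) {F : Set (Multiset (Cut W) × Multiset (Cut W))}
    (hF : ∀ p ∈ F, EdgeEq G p.1 p.2) (h : ∀ m m', EdgeEq G m m' → Linked F m m') :
    IsBinomialGeneratingSet K G F := by
  refine ⟨fun p hp => (hF p hp).1, le_antisymm ?_ ?_⟩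
  · rw [Ideal.span_le]
    rintro _ ⟨p, hp, rfl⟩
    exact (cutBinomial_mem_cutIdeal_iff K hG).2 (hF p hp)
  · exact cutIdeal_le_span K G fun m m' hm => h m m' (edgeEq_of_cutMap_eq K hG hm)

theorem exists_isBinomialGeneratingSet [Finite W] {G : SimpleGraph W}
    (hG : ∃ a b, G.Adj a b) :
    ∃ F : Set (Multiset (Cut W) × Multiset (Cut W)), IsBinomialGeneratingSet K G F :=
  ⟨{p | EdgeEq G p.1 p.2}, isBinomialGeneratingSet_of_linked K hG (fun _ h => h)
    fun _ _ h => Linked.of_mem h⟩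

end EdgeHeights

/-! ### Degrees of minimal generators -/

section MinimalGenerators

open MvPolynomial

/-- A generator f of degree above `D` is redundant: write g in `T` as a f + z with z in the ideal of
the other generators. In the degree of g the term a f contributes nothing, so g is a homogeneous
component of z and lies in that homogeneous ideal. -/
theorem IsMinimalGeneratingSet.totalDegree_le {σ K : Type*} [Field K]
    {I : Ideal (MvPolynomial σ K)} {S T : Set (MvPolynomial σ K)} {D : ℕ}
    (hT : ∀ g ∈ T, ∃ d ≤ D, g.IsHomogeneous d) (hTI : Ideal.span T = I)
    (hS : IsMinimalGeneratingSet I S) {f : MvPolynomial σ K} (hf : f ∈ S) :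
    f.totalDegree ≤ D := by
  classical
  by_contra hD
  obtain ⟨hom, hspan, hmin⟩ := hS
  have hsub : S \ {f} ⊂ S := ⟨Set.sdiff_subset, fun h => (h hf).2 rfl⟩
  refine hmin _ hsub (le_antisymm (hspan ▸ Ideal.span_mono hsub.1) ?_)
  rw [← hTI, Ideal.span_le]
  intro g hg
  obtain ⟨d, hd, hgd⟩ := hT g hg
  have hgS : g ∈ Ideal.span (insert f (S \ {f})) := by
    rw [Set.insert_sdiff_singleton, Set.insert_eq_of_mem hf, hspan, ← hTI]
    exact Ideal.subset_span hg
  obtain ⟨a, z, hz, rfl⟩ := Ideal.mem_span_insert.1 hgS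
  obtain ⟨e, he⟩ := hom f hf
  have hf0 : f ≠ 0 := by
    rintro rfl
    simp at hD
  have hde : d < e := by
    rw [← he.totalDegree hf0]
    omega
  have h1 : homogeneousComponent d (a * f) = 0 := by
    ext n
    rw [coeff_homogeneousComponent, coeff_zero]
    split_ifs with hn
    · rw [coeff_mul]
      refine Finset.sum_eq_zero fun x hx => ?_
      rw [he.coeff_eq_zero, mul_zero]
      have := Finset.HasAntidiagonal.mem_antidiagonal.1 hx
      have h2 : x.1.degree + x.2.degree = d := by rw [← map_add, this, hn]
      omega
    · rfl
  have hz' : homogeneousComponent d z ∈ Ideal.span (S \ {f}) := by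
    let _ := MvPolynomial.gradedAlgebra (σ := σ) (R := K)
    refine homogeneousComponent_mem_of_mem (Ideal.homogeneous_span _ _ ?_) hz d
    intro x hx
    obtain ⟨d, hd⟩ := hom x hx.1
    exact ⟨d, hd⟩
  rw [SetLike.mem_coe, ← homogeneousComponent_eq_self hgd, map_add, h1, zero_add]
  exact hz'

variable {W : Type*} (K : Type*) [Field K] {G : SimpleGraph W}
  {F : Set (Multiset (Cut W) × Multiset (Cut W))}

theorem IsBinomialGeneratingSet.cutMu_le (hF : IsBinomialGeneratingSet K G F) {D : ℕ}
    (hD : ∀ p ∈ F, Multiset.card p.1 ≤ D) : cutMu K G ≤ D := by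
  refine csSup_le' ?_
  rintro _ ⟨S, hS, f, hf, rfl⟩
  refine IsMinimalGeneratingSet.totalDegree_le ?_ hF.2 hS hf
  rintro _ ⟨p, hp, rfl⟩
  exact ⟨_, hD p hp, cutBinomial_isHomogeneous K (hF.1 p hp)⟩

/-- A binomial generating set contains one whose members have degree at most `μ(G)`. -/
theorem IsBinomialGeneratingSet.exists_subset_card_le [Finite W]
    (hF : IsBinomialGeneratingSet K G F) :
    ∃ F' ⊆ F, IsBinomialGeneratingSet K G F' ∧ ∀ p ∈ F', Multiset.card p.1 ≤ cutMu K G := by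
  classical
  have : Finite (Cut W) := Quotient.finite _
  have hfg : (Submodule.span (MvPolynomial (Cut W) K) (cutBinomial K '' F)).FG :=
    IsNoetherian.noetherian _
  obtain ⟨T, hTF, hT⟩ := (Submodule.fg_span_iff_fg_span_finset_subset _).1 hfg
  have hTI : Ideal.span (T : Set (MvPolynomial (Cut W) K)) = cutIdeal K G := hT.symm.trans hF.2
  obtain ⟨S, hST, hS⟩ := exists_minimal_le_of_wellFoundedLT
    (fun S : Finset (MvPolynomial (Cut W) K) =>
      Ideal.span (S : Set (MvPolynomial (Cut W) K)) = cutIdeal K G) T hTI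
  have hhom : ∀ f ∈ cutBinomial K '' F, ∃ d, f.IsHomogeneous d := by
    rintro _ ⟨p, hp, rfl⟩
    exact ⟨_, cutBinomial_isHomogeneous K (hF.1 p hp)⟩
  have hSF : (S : Set (MvPolynomial (Cut W) K)) ⊆ cutBinomial K '' F :=
    fun f hf => hTF (hST hf)
  have hSmin : IsMinimalGeneratingSet (cutIdeal K G) (S : Set (MvPolynomial (Cut W) K)) := by
    refine ⟨fun f hf => hhom f (hSF hf), hS.1, fun U hU hUI => ?_⟩
    have hUfin : U.Finite := S.finite_toSet.subset hU.1
    have hU' : hUfin.toFinset ≤ S := fun x hx => hU.1 (hUfin.mem_toFinset.1 hx)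
    have := hS.2 (y := hUfin.toFinset) (by simpa using hUI) hU'
    exact hU.2 fun x hx => hUfin.mem_toFinset.1 (this hx)
  -- In ℕ an unbounded set has `sSup` equal to 0, so μ bounds degrees only once boundedness is
  -- known.
  have hbdd : BddAbove {d | ∃ S, IsMinimalGeneratingSet (cutIdeal K G) S ∧
      ∃ f ∈ S, f.totalDegree = d} := by
    refine ⟨S.sup totalDegree, ?_⟩
    rintro _ ⟨S', hS', f, hf, rfl⟩
    refine IsMinimalGeneratingSet.totalDegree_le (fun g hg => ?_) hS.1 hS' hf
    obtain ⟨d, hd⟩ := hhom g (hSF hg)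
    by_cases hg0 : g = 0
    · exact ⟨0, Nat.zero_le _, hg0 ▸ isHomogeneous_zero _ _ _⟩
    · exact ⟨d, hd.totalDegree hg0 ▸ Finset.le_sup hg, hd⟩
  refine ⟨{p | p ∈ F ∧ cutBinomial K p ∈ S}, fun p hp => hp.1,
    ⟨fun p hp => hF.1 p hp.1, ?_⟩, ?_⟩
  · rw [← hSmin.2.1]
    congr 1
    ext f
    constructor
    · rintro ⟨p, hp, rfl⟩
      exact hp.2
    · intro hf
      obtain ⟨p, hp, rfl⟩ := hSF hf
      exact ⟨p, ⟨hp, hf⟩, rfl⟩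
  · rintro p ⟨hp, hpS⟩
    -- The total degree equals the cardinality only for nonzero binomials; minimality excludes the
    -- zero one.
    have h0 : cutBinomial K p ≠ 0 := by
      intro h0
      refine hSmin.2.2 ((S : Set (MvPolynomial (Cut W) K)) \ {0})
        ⟨Set.sdiff_subset, fun h => (h hpS).2 h0⟩ ?_
      rw [Ideal.span_sdiff_singleton_zero, hSmin.2.1]
    rw [← (cutBinomial_isHomogeneous K (hF.1 p hp)).totalDegree h0]
    exact le_csSup hbdd ⟨_, hSmin, _, hpS, rfl⟩

end MinimalGenerators

/-! ### Gluing cuts and moves along two vertices -/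

section TwoSeparation

variable {V : Type*}

/-- The vertex sets `L` and `R` cover `V` and meet exactly in the two vertices `u` and `v`. -/
structure IsTwoSeparation (u v : V) (L R : Set V) : Prop where
  ne : u ≠ v
  leftL : u ∈ L
  rightL : v ∈ L
  leftR : u ∈ R
  rightR : v ∈ R
  union : L ∪ R = Set.univ
  inter : L ∩ R = {u, v}

variable {u v : V} {L R : Set V}

theorem IsTwoSeparation.symm (h : IsTwoSeparation u v L R) : IsTwoSeparation u v R L :=
  ⟨h.ne, h.leftR, h.rightR, h.leftL, h.rightL, Set.union_comm L R ▸ h.union,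
    Set.inter_comm L R ▸ h.inter⟩

theorem Cut.separates_restrict (S : Set V) (c : Cut V) (a b : S) :
    (c.restrict S).Separates a b ↔ c.Separates (a : V) b := by
  obtain ⟨A, rfl⟩ := c.exists_mk
  exact Iff.rfl

/-- With both representatives chosen to contain u, the hypothesis says that they agree at v too,
hence on L ∩ R, so their union restricts correctly. -/
theorem IsTwoSeparation.exists_cut (h : IsTwoSeparation u v L R) (a : Cut L) (b : Cut R)
    (hab : a.Separates ⟨u, h.leftL⟩ ⟨v, h.rightL⟩ ↔ b.Separates ⟨u, h.leftR⟩ ⟨v, h.rightR⟩) :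
    ∃ c : Cut V, c.restrict L = a ∧ c.restrict R = b := by
  obtain ⟨A, hA, rfl⟩ := a.exists_mk_mem ⟨u, h.leftL⟩
  obtain ⟨B, hB, rfl⟩ := b.exists_mk_mem ⟨u, h.leftR⟩
  simp only [Cut.separates_mk, hA, hB, true_iff, not_iff_not] at hab
  have hmem : ∀ x, x ∈ L → x ∈ R → x = u ∨ x = v := fun x h1 h2 => by
    have : x ∈ L ∩ R := ⟨h1, h2⟩
    rwa [h.inter] at this
  refine ⟨Cut.mk (Subtype.val '' A ∪ Subtype.val '' B), ?_, ?_⟩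
  · refine congrArg Cut.mk (?_ : (Subtype.val ⁻¹' _ : Set L) = A)
    ext ⟨x, hx⟩
    constructor
    · rintro (⟨y, hy, rfl⟩ | ⟨y, hy, rfl⟩)
      · exact hy
      · rcases hmem y hx y.2 with h1 | h1
        · convert hA
        · have h2 : y = ⟨v, h.rightR⟩ := Subtype.ext h1
          have h3 := hab.2 (h2 ▸ hy)
          convert h3
    · exact fun hA' => Or.inl ⟨_, hA', rfl⟩
  · refine congrArg Cut.mk (?_ : (Subtype.val ⁻¹' _ : Set R) = B)
    ext ⟨x, hx⟩
    constructor
    · rintro (⟨y, hy, rfl⟩ | ⟨y, hy, rfl⟩)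
      · rcases hmem y y.2 hx with h1 | h1
        · convert hB
        · have h2 : y = ⟨v, h.rightL⟩ := Subtype.ext h1
          have h3 := hab.1 (h2 ▸ hy)
          convert h3
      · exact hy
    · exact fun hB' => Or.inr ⟨_, hB', rfl⟩

theorem Cut.preimage_eq_of_restrict_eq {S : Set V} {C C' : Set V} {a : V} (ha : a ∈ S)
    (hC : a ∈ C) (hC' : a ∈ C') (h : (Cut.mk C).restrict S = (Cut.mk C').restrict S) {x : V}
    (hx : x ∈ S) : x ∈ C ↔ x ∈ C' := by
  rcases Quotient.exact h with h | h
  · exact Set.ext_iff.1 h ⟨x, hx⟩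
  · have := Set.ext_iff.1 h ⟨a, ha⟩
    exact absurd hC' (this.1 hC)

theorem IsTwoSeparation.cut_ext (h : IsTwoSeparation u v L R) {c c' : Cut V}
    (hL : c.restrict L = c'.restrict L) (hR : c.restrict R = c'.restrict R) : c = c' := by
  obtain ⟨C, hC, rfl⟩ := c.exists_mk_mem u
  obtain ⟨C', hC', rfl⟩ := c'.exists_mk_mem u
  congr 1
  ext x
  rcases (h.union ▸ Set.mem_univ x : x ∈ L ∪ R) with hx | hx
  · exact Cut.preimage_eq_of_restrict_eq h.leftL hC hC' hL hx
  · exact Cut.preimage_eq_of_restrict_eq h.leftR hC hC' hR hx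

theorem exists_separates_of_height_pos {W : Type*} {a b : W} {m : Multiset (Cut W)}
    (h : 0 < height a b m) : ∃ c ∈ m, c.Separates a b := by
  classical
  exact Multiset.countP_pos.1 h

theorem exists_not_separates_of_height_lt {W : Type*} {a b : W} {m : Multiset (Cut W)}
    (h : height a b m < Multiset.card m) : ∃ c ∈ m, ¬ c.Separates a b := by
  classical
  by_contra! hne
  exact h.ne (Multiset.countP_eq_card.2 hne)

/-- Lists of cuts on the two sides of equal length and equal height come from a list of cuts. -/
theorem IsTwoSeparation.exists_multiset (h : IsTwoSeparation u v L R) (a : Multiset (Cut L))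
    (b : Multiset (Cut R)) (hcard : Multiset.card a = Multiset.card b)
    (hheight : height ⟨u, h.leftL⟩ ⟨v, h.rightL⟩ a = height ⟨u, h.leftR⟩ ⟨v, h.rightR⟩ b) :
    ∃ p : Multiset (Cut V), p.map (Cut.restrict L) = a ∧ p.map (Cut.restrict R) = b := by
  classical
  induction a using Multiset.induction_on generalizing b with
  | empty =>
    rw [Multiset.card_zero, eq_comm, Multiset.card_eq_zero] at hcard
    exact ⟨0, by simp [hcard]⟩
  | cons c a ih =>
    have hd : ∃ d ∈ b, (c.Separates ⟨u, h.leftL⟩ ⟨v, h.rightL⟩ ↔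
        d.Separates ⟨u, h.leftR⟩ ⟨v, h.rightR⟩) := by
      rw [height_cons] at hheight
      rw [Multiset.card_cons] at hcard
      by_cases hc : c.Separates ⟨u, h.leftL⟩ ⟨v, h.rightL⟩
      · rw [if_pos hc] at hheight
        obtain ⟨d, hd, hd'⟩ := exists_separates_of_height_pos
          (show 0 < height ⟨u, h.leftR⟩ ⟨v, h.rightR⟩ b by omega)
        exact ⟨d, hd, iff_of_true hc hd'⟩
      · rw [if_neg hc] at hheight
        have := height_le_card (⟨u, h.leftL⟩ : L) ⟨v, h.rightL⟩ a
        obtain ⟨d, hd, hd'⟩ := exists_not_separates_of_height_lt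
          (show height ⟨u, h.leftR⟩ ⟨v, h.rightR⟩ b < Multiset.card b by omega)
        exact ⟨d, hd, iff_of_false hc hd'⟩
    obtain ⟨d, hd, hcd⟩ := hd
    obtain ⟨b, rfl⟩ := Multiset.exists_cons_of_mem hd
    obtain ⟨e, he, he'⟩ := h.exists_cut c d hcd
    simp only [Multiset.card_cons, add_left_inj] at hcard
    simp only [height_cons, hcd, add_left_inj] at hheight
    obtain ⟨p, hp, hp'⟩ := ih b hcard hheight
    exact ⟨e ::ₘ p, by simp [he, hp], by simp [he', hp']⟩

theorem Linked.mono {α : Type*} {F F' : Set (Multiset α × Multiset α)} (h : F ⊆ F')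
    {x y : Multiset α} (hxy : Linked F x y) : Linked F' x y :=
  Relation.ReflTransGen.mono
    (fun _ _ ⟨r, q, q', hq, hx, hy⟩ => ⟨r, q, q', hq.imp (@h _) (@h _), hx, hy⟩) _ _ hxy

theorem Multiset.exists_add_of_map_eq_add {α β : Type*} (f : α → β) {m : Multiset α}
    {s t : Multiset β} (h : m.map f = s + t) :
    ∃ m₁ m₂, m₁.map f = s ∧ m₂.map f = t ∧ m = m₁ + m₂ := by
  induction s using Multiset.induction_on generalizing m with
  | empty => exact ⟨0, m, rfl, by simpa using h, by simp⟩
  | cons b s ih =>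
    rw [Multiset.cons_add] at h
    obtain ⟨a, ha, rfl⟩ := Multiset.mem_map.1 (h ▸ Multiset.mem_cons_self b (s + t))
    obtain ⟨m, rfl⟩ := Multiset.exists_cons_of_mem ha
    rw [Multiset.map_cons, Multiset.cons_inj_right] at h
    obtain ⟨m₁, m₂, h₁, h₂, rfl⟩ := ih h
    exact ⟨a ::ₘ m₁, m₂, by simp [h₁], h₂, by simp⟩

/-- Lists of cuts with the same restrictions to both sides differ by reorderings. -/
theorem IsTwoSeparation.linked_reorderings (h : IsTwoSeparation u v L R)
    {p p' : Multiset (Cut V)} (hL : p.map (Cut.restrict L) = p'.map (Cut.restrict L))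
    (hR : p.map (Cut.restrict R) = p'.map (Cut.restrict R)) :
    Linked (reorderings L R) p p' := by
  induction p using Multiset.induction_on generalizing p' with
  | empty =>
    rw [Multiset.map_zero, eq_comm, Multiset.map_eq_zero] at hL
    rw [hL]
    exact .refl
  | cons c p ih =>
    obtain ⟨c', hc', hcL⟩ := Multiset.mem_map.1
      (hL ▸ Multiset.mem_map_of_mem _ (Multiset.mem_cons_self c p))
    obtain ⟨c'', hc'', hcR⟩ := Multiset.mem_map.1
      (hR ▸ Multiset.mem_map_of_mem _ (Multiset.mem_cons_self c p))
    obtain ⟨p', rfl⟩ := Multiset.exists_cons_of_mem hc'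
    rcases Multiset.mem_cons.1 hc'' with rfl | hc''
    · have := h.cut_ext hcL hcR
      subst this
      simp only [Multiset.map_cons, Multiset.cons_inj_right] at hL hR
      simpa only [Multiset.singleton_add] using (ih hL hR).add_left {c''}
    · obtain ⟨p', rfl⟩ := Multiset.exists_cons_of_mem hc''
      -- The cut `c` has the L-side of `c'` and the R-side of `c''`; `d` takes the two remaining
      -- sides, so `c`, `d` is a reordering of `c'`, `c''`.
      obtain ⟨d, hdL, hdR⟩ := h.exists_cut (c''.restrict L) (c'.restrict R) (by
        have h1 : ∀ c : Cut V, (c.restrict L).Separates ⟨u, h.leftL⟩ ⟨v, h.rightL⟩ ↔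
            (c.restrict R).Separates ⟨u, h.leftR⟩ ⟨v, h.rightR⟩ := fun c => by
          rw [Cut.separates_restrict, Cut.separates_restrict]
        rw [h1 c'', hcR, ← h1 c, ← hcL, h1 c'])
      have hlink : Linked (reorderings L R) (c ::ₘ d ::ₘ p') (c' ::ₘ c'' ::ₘ p') := by
        have : Linked (reorderings L R) {c, d} {c', c''} :=
          .of_mem ⟨c, d, c', c'', rfl, hcL.symm, hdL, hcR.symm, hdR⟩
        convert this.add_left p' using 1 <;>
          simp only [Multiset.insert_eq_cons, ← Multiset.singleton_add, add_comm p', add_assoc]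
      refine Relation.ReflTransGen.trans ?_ hlink
      have h2 : Linked (reorderings L R) p (d ::ₘ p') := by
        refine ih ?_ ?_
        · simp only [Multiset.map_cons, hcL, hdL, Multiset.cons_inj_right] at hL ⊢
          exact hL
        · simp only [Multiset.map_cons, hcR, hdR] at hR ⊢
          rwa [Multiset.cons_swap, Multiset.cons_inj_right] at hR
      exact h2.add_left {c}

theorem height_restrict_eq (h : IsTwoSeparation u v L R) (p : Multiset (Cut V)) :
    height ⟨u, h.leftL⟩ ⟨v, h.rightL⟩ (p.map (Cut.restrict L)) =
      height ⟨u, h.leftR⟩ ⟨v, h.rightR⟩ (p.map (Cut.restrict R)) := by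
  rw [height_map_restrict, height_map_restrict]

/-- Height-preserving exchanges on one side lift. -/
theorem IsTwoSeparation.exists_linked_lifts (h : IsTwoSeparation u v L R)
    {F : Set (Multiset (Cut L) × Multiset (Cut L))}
    (hF : ∀ p ∈ F, Multiset.card p.1 = Multiset.card p.2 ∧
      height ⟨u, h.leftL⟩ ⟨v, h.rightL⟩ p.1 = height ⟨u, h.leftL⟩ ⟨v, h.rightL⟩ p.2)
    {p : Multiset (Cut V)} {a : Multiset (Cut L)}
    (hpa : Linked F (p.map (Cut.restrict L)) a) :
    ∃ p', p'.map (Cut.restrict L) = a ∧ p'.map (Cut.restrict R) = p.map (Cut.restrict R) ∧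
      Linked (lifts L R F) p p' := by
  classical
  induction hpa with
  | refl => exact ⟨p, rfl, rfl, .refl⟩
  | tail _ hs ih =>
    obtain ⟨p', hL, hR, hlink⟩ := ih
    obtain ⟨r, q, q', hq, rfl, rfl⟩ := hs
    obtain ⟨p₁, p₂, rfl, rfl, rfl⟩ := Multiset.exists_add_of_map_eq_add _ hL
    have hq' : Multiset.card q' = Multiset.card (p₂.map (Cut.restrict L)) ∧
        height ⟨u, h.leftL⟩ ⟨v, h.rightL⟩ q' =
          height ⟨u, h.leftL⟩ ⟨v, h.rightL⟩ (p₂.map (Cut.restrict L)) := by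
      rcases hq with hq | hq
      · exact ⟨(hF _ hq).1.symm, (hF _ hq).2.symm⟩
      · exact hF _ hq
    obtain ⟨p₃, h3L, h3R⟩ := h.exists_multiset q' (p₂.map (Cut.restrict R))
      (by rw [hq'.1]; simp) (by rw [hq'.2, height_restrict_eq h])
    refine ⟨p₁ + p₃, by simp [h3L], by rw [← hR]; simp [h3R], ?_⟩
    refine hlink.tail ⟨p₁, p₂, p₃, ?_, rfl, rfl⟩
    exact hq.imp (fun hq => ⟨by simpa only [h3L] using hq, h3R.symm⟩)
      (fun hq => ⟨by simpa only [h3L] using hq, h3R⟩)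

/-- A lift from one side leaves the restrictions to the other side untouched, so both sides can be
adjusted independently. Only the pairing of L-sides with R-sides may then differ, which reorderings
repair. -/
theorem IsTwoSeparation.linked_of_linked (h : IsTwoSeparation u v L R)
    {FL : Set (Multiset (Cut L) × Multiset (Cut L))}
    {FR : Set (Multiset (Cut R) × Multiset (Cut R))}
    (hFL : ∀ p ∈ FL, Multiset.card p.1 = Multiset.card p.2 ∧
      height ⟨u, h.leftL⟩ ⟨v, h.rightL⟩ p.1 = height ⟨u, h.leftL⟩ ⟨v, h.rightL⟩ p.2)
    (hFR : ∀ p ∈ FR, Multiset.card p.1 = Multiset.card p.2 ∧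
      height ⟨u, h.leftR⟩ ⟨v, h.rightR⟩ p.1 = height ⟨u, h.leftR⟩ ⟨v, h.rightR⟩ p.2)
    {p p' : Multiset (Cut V)}
    (hL : Linked FL (p.map (Cut.restrict L)) (p'.map (Cut.restrict L)))
    (hR : Linked FR (p.map (Cut.restrict R)) (p'.map (Cut.restrict R))) :
    Linked (lifts L R FL ∪ lifts R L FR ∪ reorderings L R) p p' := by
  obtain ⟨p₁, h1L, h1R, hlink₁⟩ := h.exists_linked_lifts hFL hL
  rw [← h1R] at hR
  obtain ⟨p₂, h2R, h2L, hlink₂⟩ := h.symm.exists_linked_lifts hFR hR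
  have hlink₃ := h.linked_reorderings (h2L.trans h1L) h2R
  exact ((hlink₁.mono fun _ hx => Or.inl (Or.inl hx)).trans
    (hlink₂.mono fun _ hx => Or.inl (Or.inr hx))).trans (hlink₃.mono fun _ hx => Or.inr hx)

/-- If all exchanges of `F` change the height by `0` or `±2`, then a chain of exchanges to a larger
height has a step that raises the initial height by two. -/
theorem Linked.exists_step_height_add_two {W : Type*} {a b : W}
    {F : Set (Multiset (Cut W) × Multiset (Cut W))}
    (hF : ∀ p ∈ F, |(height a b p.1 : ℤ) - (height a b p.2 : ℤ)| ≤ 2)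
    (hpar : ∀ x y, Linked F x y → height a b x % 2 = height a b y % 2)
    {x y : Multiset (Cut W)} (hxy : Linked F x y) (hlt : height a b x < height a b y) :
    ∃ r q q', ((q, q') ∈ F ∨ (q', q) ∈ F) ∧ Linked F x (r + q) ∧
      height a b (r + q) = height a b x ∧ height a b q' = height a b q + 2 := by
  classical
  suffices H : height a b y ≤ height a b x ∨ ∃ r q q', ((q, q') ∈ F ∨ (q', q) ∈ F) ∧
      Linked F x (r + q) ∧ height a b (r + q) = height a b x ∧
        height a b q' = height a b q + 2 from H.resolve_left (not_le.2 hlt)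
  clear hlt
  induction hxy with
  | refl => exact Or.inl le_rfl
  | @tail y z hxy hyz ih =>
    rcases ih with ih | ih
    -- At a step crossing above the height of `x`, equal parity and a jump of at most two force the
    -- step to start exactly at that height and to raise it by exactly two.
    · by_cases hz : height a b z ≤ height a b x
      · exact Or.inl hz
      · have h1 := hpar _ _ hxy
        have h2 := hpar _ _ (Relation.ReflTransGen.tail hxy hyz)
        obtain ⟨r, q, q', hq, rfl, rfl⟩ := hyz
        have h3 : height a b q' ≤ height a b q + 2 := by
          rcases hq with hq | hq
          · have := abs_le.1 (hF (q, q') hq)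
            dsimp only at this
            omega
          · have := abs_le.1 (hF (q', q) hq)
            dsimp only at this
            omega
        simp only [height_add] at h1 h2 hz ih
        refine Or.inr ⟨r, q, q', hq, hxy, ?_, ?_⟩
        · rw [height_add]
          omega
        · omega
    · exact Or.inr ih

theorem height_eq_card_of_forall {W : Type*} {a b : W} {m : Multiset (Cut W)}
    (h : ∀ c ∈ m, c.Separates a b) : height a b m = Multiset.card m := by
  classical
  exact Multiset.countP_eq_card.2 h

theorem height_eq_zero_of_forall {W : Type*} {a b : W} {m : Multiset (Cut W)}
    (h : ∀ c ∈ m, ¬ c.Separates a b) : height a b m = 0 := by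
  classical
  exact Multiset.countP_eq_zero.2 h

/-- If no member of `r` agrees with a member of `r'`, then one of the two is empty, or one of them
consists of separating cuts and the other one of non-separating cuts. -/
theorem height_of_forall_not_iff {W W' : Type*} {a b : W} {a' b' : W'} {r : Multiset (Cut W)}
    {r' : Multiset (Cut W')}
    (h : ¬ ∃ c ∈ r, ∃ d ∈ r', (c.Separates a b ↔ d.Separates a' b')) :
    Multiset.card r = 0 ∨ Multiset.card r' = 0 ∨
      (height a b r = Multiset.card r ∧ height a' b' r' = 0) ∨
      (height a b r = 0 ∧ height a' b' r' = Multiset.card r') := by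
  push Not at h
  rcases r.empty_or_exists_mem with rfl | ⟨c, hc⟩
  · exact Or.inl rfl
  rcases r'.empty_or_exists_mem with rfl | ⟨d, hd⟩
  · exact Or.inr (Or.inl rfl)
  by_cases hs : c.Separates a b
  · have h1 : ∀ d ∈ r', ¬ d.Separates a' b' := fun d hd => by
      have := h c hc d hd
      tauto
    refine Or.inr (Or.inr (Or.inl ⟨height_eq_card_of_forall fun c hc => ?_,
      height_eq_zero_of_forall h1⟩))
    have := h c hc d hd
    have := h1 d hd
    tauto
  · have h1 : ∀ d ∈ r', d.Separates a' b' := fun d hd => by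
      have := h c hc d hd
      tauto
    refine Or.inr (Or.inr (Or.inr ⟨height_eq_zero_of_forall fun c hc => ?_,
      height_eq_card_of_forall h1⟩))
    have := h c hc d hd
    have := h1 d hd
    tauto

/-- Height-raising exchanges on the two sides, after cancelling common factors, form a join. -/
theorem IsTwoSeparation.exists_linked_joins (h : IsTwoSeparation u v L R)
    {FL : Set (Multiset (Cut L) × Multiset (Cut L))}
    {FR : Set (Multiset (Cut R) × Multiset (Cut R))}
    {q₁ q₂ : Multiset (Cut L)} {q₃ q₄ : Multiset (Cut R)}
    (hqL : (q₁, q₂) ∈ FL ∨ (q₂, q₁) ∈ FL) (hqR : (q₃, q₄) ∈ FR ∨ (q₄, q₃) ∈ FR)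
    (hcardL : Multiset.card q₁ = Multiset.card q₂) (hcardR : Multiset.card q₃ = Multiset.card q₄)
    (hhL : height ⟨u, h.leftL⟩ ⟨v, h.rightL⟩ q₂ = height ⟨u, h.leftL⟩ ⟨v, h.rightL⟩ q₁ + 2)
    (hhR : height ⟨u, h.leftR⟩ ⟨v, h.rightR⟩ q₄ = height ⟨u, h.leftR⟩ ⟨v, h.rightR⟩ q₃ + 2)
    (r : Multiset (Cut L)) (r' : Multiset (Cut R))
    (hcard : Multiset.card (r + q₁) = Multiset.card (r' + q₃))
    (hheight : height ⟨u, h.leftL⟩ ⟨v, h.rightL⟩ (r + q₁) =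
      height ⟨u, h.leftR⟩ ⟨v, h.rightR⟩ (r' + q₃)) :
    ∃ p₁ p₂ : Multiset (Cut V),
      p₁.map (Cut.restrict L) = r + q₁ ∧ p₁.map (Cut.restrict R) = r' + q₃ ∧
      p₂.map (Cut.restrict L) = r + q₂ ∧ p₂.map (Cut.restrict R) = r' + q₄ ∧
      Linked (joins L R ⟨u, h.leftL⟩ ⟨v, h.rightL⟩ ⟨u, h.leftR⟩ ⟨v, h.rightR⟩ FL FR) p₁ p₂ := by
  classical
  induction r using Multiset.strongInductionOn generalizing r' with
  | ih r ih =>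
    by_cases hcd : ∃ c ∈ r, ∃ d ∈ r', (c.Separates ⟨u, h.leftL⟩ ⟨v, h.rightL⟩ ↔
        d.Separates ⟨u, h.leftR⟩ ⟨v, h.rightR⟩)
    · obtain ⟨c, hc, d, hd, hcd⟩ := hcd
      obtain ⟨r, rfl⟩ := Multiset.exists_cons_of_mem hc
      obtain ⟨r', rfl⟩ := Multiset.exists_cons_of_mem hd
      obtain ⟨e, heL, heR⟩ := h.exists_cut c d hcd
      simp only [Multiset.cons_add, Multiset.card_cons, add_left_inj] at hcard
      simp only [Multiset.cons_add, height_cons, hcd, add_left_inj] at hheight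
      obtain ⟨p₁, p₂, h1, h2, h3, h4, hlink⟩ :=
        ih r (Multiset.lt_cons_self r c) r' hcard hheight
      refine ⟨e ::ₘ p₁, e ::ₘ p₂, by simp [heL, h1], by simp [heR, h2], by simp [heL, h3],
        by simp [heR, h4], ?_⟩
      simpa only [Multiset.singleton_add] using hlink.add_left {e}
    -- No common factor is left. If `r` or `r'` is empty, the degree bound holds since both `q₂` and
    -- `q₄` have height, hence degree, at least 2. If `r` is all separating and `r'` not at all,
    -- then |r| ≤ h(q₃) = h(q₄) - 2 ≤ deg q₃ - 2; the remaining case is symmetric.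
    · have hcases := height_of_forall_not_iff hcd
      have hq₂ := height_le_card (⟨u, h.leftL⟩ : L) ⟨v, h.rightL⟩ q₂
      have hq₄ := height_le_card (⟨u, h.leftR⟩ : R) ⟨v, h.rightR⟩ q₄
      obtain ⟨p₁, h1, h2⟩ := h.exists_multiset _ _ hcard hheight
      simp only [height_add, Multiset.card_add] at hcard hheight
      obtain ⟨p₂, h3, h4⟩ := h.exists_multiset (r + q₂) (r' + q₄)
        (by simp only [Multiset.card_add]; omega) (by simp only [height_add]; omega)
      refine ⟨p₁, p₂, h1, h2, h3, h4, Linked.of_mem ⟨q₁, q₂, r, q₃, q₄, r', hqL, hqR, ?_, ?_,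
        h1, h3, h2, h4, ?_⟩⟩
      · rw [hhL]
        simp
      · rw [hhR]
        simp
      · have h5 : Multiset.card p₁ = Multiset.card r + Multiset.card q₁ := by
          rw [← Multiset.card_map (Cut.restrict L), h1, Multiset.card_add]
        simp only
        omega

end TwoSeparation

/-! ### Generation of the glued cut ideal -/

section Generation

variable {V : Type*} {u v : V} {L R : Set V}

theorem edgeEq_restrict_iff {G : SimpleGraph V}
    (hedges : ∀ a b, G.Adj a b → (a ∈ L ∧ b ∈ L) ∨ (a ∈ R ∧ b ∈ R))
    {p p' : Multiset (Cut V)} :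
    EdgeEq G p p' ↔
      EdgeEq (G.induce L) (p.map (Cut.restrict L)) (p'.map (Cut.restrict L)) ∧
      EdgeEq (G.induce R) (p.map (Cut.restrict R)) (p'.map (Cut.restrict R)) := by
  simp only [EdgeEq, Multiset.card_map, height_map_restrict, SimpleGraph.comap_adj,
    Function.Embedding.subtype_apply]
  constructor
  · exact fun h => ⟨⟨h.1, fun a b hab => h.2 a b hab⟩, ⟨h.1, fun a b hab => h.2 a b hab⟩⟩
  · rintro ⟨hL, hR⟩
    refine ⟨hL.1, fun a b hab => ?_⟩
    rcases hedges a b hab with ⟨ha, hb⟩ | ⟨ha, hb⟩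
    · exact hL.2 ⟨a, ha⟩ ⟨b, hb⟩ hab
    · exact hR.2 ⟨a, ha⟩ ⟨b, hb⟩ hab

/-- This is why generators for the graph with the added edge serve as the height-preserving moves.
-/
theorem edgeEq_sup_edge_iff {W : Type*} {G : SimpleGraph W} {a b : W} (hab : a ≠ b)
    {m m' : Multiset (Cut W)} :
    EdgeEq (G ⊔ SimpleGraph.edge a b) m m' ↔
      EdgeEq G m m' ∧ height a b m = height a b m' := by
  constructor
  · intro h
    refine ⟨⟨h.1, fun x y hxy => h.2 x y (Or.inl hxy)⟩, h.2 a b (Or.inr ?_)⟩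
    rw [SimpleGraph.edge_adj]
    exact ⟨Or.inl ⟨rfl, rfl⟩, hab⟩
  · rintro ⟨h, hh⟩
    refine ⟨h.1, fun x y hxy => ?_⟩
    rcases hxy with hxy | hxy
    · exact h.2 x y hxy
    · rw [SimpleGraph.edge_adj] at hxy
      rcases hxy.1 with ⟨rfl, rfl⟩ | ⟨rfl, rfl⟩
      · exact hh
      · rw [height_comm, hh, height_comm]

theorem EdgeEq.add_left {W : Type*} {G : SimpleGraph W} {m m' : Multiset (Cut W)}
    (r : Multiset (Cut W)) (h : EdgeEq G m m') : EdgeEq G (r + m) (r + m') :=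
  ⟨by rw [Multiset.card_add, Multiset.card_add, h.1],
    fun a b hab => by rw [height_add, height_add, h.2 a b hab]⟩

theorem exists_adj_of_reachable {W : Type*} {G : SimpleGraph W} {a b : W} (hab : a ≠ b)
    (h : G.Reachable a b) : ∃ x y, G.Adj x y := by
  obtain ⟨w⟩ := h
  cases w with
  | nil => exact absurd rfl hab
  | cons hxy _ => exact ⟨_, _, hxy⟩

/-- If `F` contains enough binomials, at fixed height and to raise the height by two, then it
connects all lists of cuts with the same edge heights. -/
theorem linked_of_height_le {W : Type*} {G : SimpleGraph W}
    {F : Set (Multiset (Cut W) × Multiset (Cut W))} {a b : W} (hab : G.Reachable a b)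
    (hfix : ∀ p p', EdgeEq G p p' → height a b p = height a b p' → Linked F p p')
    (hraise : ∀ p p', EdgeEq G p p' → height a b p < height a b p' →
      ∃ p₁, EdgeEq G p p₁ ∧ height a b p₁ = height a b p + 2 ∧ Linked F p p₁)
    {p p' : Multiset (Cut W)} (h : EdgeEq G p p') : Linked F p p' := by
  have key : ∀ n p p', EdgeEq G p p' → height a b p ≤ height a b p' →
      height a b p' - height a b p = n → Linked F p p' := by
    intro n
    induction n using Nat.strong_induction_on with
    | _ n ih =>
      intro p p' h hle hn
      rcases hle.eq_or_lt with heq | hlt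
      · exact hfix p p' h heq
      · obtain ⟨p₁, h₁, hh₁, hl⟩ := hraise p p' h hlt
        -- By parity the gap is at least two, so the raise does not overshoot.
        have hpar := h.height_mod_two hab
        exact hl.trans (ih _ (by omega) p₁ p' (h₁.symm.trans h) (by omega) rfl)
  rcases le_total (height a b p) (height a b p') with hle | hle
  · exact key _ p p' h hle rfl
  · exact (key _ p' p h.symm hle rfl).symm

variable (K : Type*) [Field K]

/-- The cut ideal of a gluing along two vertices is generated by lifts, joins and reorderings. -/
theorem IsTwoSeparation.isBinomialGeneratingSet [Finite V] (h : IsTwoSeparation u v L R)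
    {G : SimpleGraph V} (hedges : ∀ a b, G.Adj a b → (a ∈ L ∧ b ∈ L) ∨ (a ∈ R ∧ b ∈ R))
    (hpathL : (G.induce L).Reachable ⟨u, h.leftL⟩ ⟨v, h.rightL⟩)
    (hpathR : (G.induce R).Reachable ⟨u, h.leftR⟩ ⟨v, h.rightR⟩)
    {FL FLuv : Set (Multiset (Cut L) × Multiset (Cut L))}
    {FR FRuv : Set (Multiset (Cut R) × Multiset (Cut R))}
    (hFL : IsSlowVarying K (G.induce L) ⟨u, h.leftL⟩ ⟨v, h.rightL⟩ FL)
    (hFR : IsSlowVarying K (G.induce R) ⟨u, h.leftR⟩ ⟨v, h.rightR⟩ FR)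
    (hFLuv : IsBinomialGeneratingSet K
      (G.induce L ⊔ SimpleGraph.edge ⟨u, h.leftL⟩ ⟨v, h.rightL⟩) FLuv)
    (hFRuv : IsBinomialGeneratingSet K
      (G.induce R ⊔ SimpleGraph.edge ⟨u, h.leftR⟩ ⟨v, h.rightR⟩) FRuv) :
    IsBinomialGeneratingSet K G (lifts L R FLuv ∪ lifts R L FRuv ∪
      joins L R ⟨u, h.leftL⟩ ⟨v, h.rightL⟩ ⟨u, h.leftR⟩ ⟨v, h.rightR⟩ FL FR ∪
        reorderings L R) := by
  have hneL : (⟨u, h.leftL⟩ : L) ≠ ⟨v, h.rightL⟩ := fun h' => h.ne (congrArg Subtype.val h')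
  have hneR : (⟨u, h.leftR⟩ : R) ≠ ⟨v, h.rightR⟩ := fun h' => h.ne (congrArg Subtype.val h')
  have hGL := exists_adj_of_reachable hneL hpathL
  have hGR := exists_adj_of_reachable hneR hpathR
  have hpath : G.Reachable u v := hpathL.map (SimpleGraph.Embedding.induce L).toHom
  have hG := exists_adj_of_reachable h.ne hpath
  have hGLuv : ∃ x y, (G.induce L ⊔ SimpleGraph.edge ⟨u, h.leftL⟩ ⟨v, h.rightL⟩).Adj x y :=
    hGL.imp fun _ => Exists.imp fun _ => Or.inl
  have hGRuv : ∃ x y, (G.induce R ⊔ SimpleGraph.edge ⟨u, h.leftR⟩ ⟨v, h.rightR⟩).Adj x y :=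
    hGR.imp fun _ => Exists.imp fun _ => Or.inl
  have linkL := fun m m' => hFL.1.linked_iff K hGL (m := m) (m' := m')
  have linkR := fun m m' => hFR.1.linked_iff K hGR (m := m) (m' := m')
  have linkLuv := fun m m' => (hFLuv.linked_iff K hGLuv (m := m) (m' := m')).trans
    (edgeEq_sup_edge_iff hneL)
  have linkRuv := fun m m' => (hFRuv.linked_iff K hGRuv (m := m) (m' := m')).trans
    (edgeEq_sup_edge_iff hneR)
  have memL : ∀ q q', ((q, q') ∈ FL ∨ (q', q) ∈ FL) → EdgeEq (G.induce L) q q' := by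
    rintro q q' (hq | hq)
    · exact (linkL q q').1 (.of_mem hq)
    · exact ((linkL q' q).1 (.of_mem hq)).symm
  have memR : ∀ q q', ((q, q') ∈ FR ∨ (q', q) ∈ FR) → EdgeEq (G.induce R) q q' := by
    rintro q q' (hq | hq)
    · exact (linkR q q').1 (.of_mem hq)
    · exact ((linkR q' q).1 (.of_mem hq)).symm
  have memLuv := fun p (hp : p ∈ FLuv) => (linkLuv p.1 p.2).1 (.of_mem hp)
  have memRuv := fun p (hp : p ∈ FRuv) => (linkRuv p.1 p.2).1 (.of_mem hp)
  have hiff := fun p p' => edgeEq_restrict_iff (p := p) (p' := p') hedges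
  have refl : ∀ {W : Type _} (H : SimpleGraph W) (m : Multiset (Cut W)), EdgeEq H m m :=
    fun _ _ => ⟨rfl, fun _ _ _ => rfl⟩
  refine isBinomialGeneratingSet_of_linked K hG ?_ fun m m' => linked_of_height_le hpath ?_ ?_
  · rintro p (((hp | hp) | hp) | hp)
    · exact (hiff _ _).2 ⟨(memLuv _ hp.1).1, hp.2 ▸ refl _ _⟩
    · exact (hiff _ _).2 ⟨hp.2 ▸ refl _ _, (memRuv _ hp.1).1⟩
    · obtain ⟨q₁, q₂, r, q₃, q₄, r', hqL, hqR, -, -, h1, h2, h3, h4, -⟩ := hp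
      rw [hiff, h1, h2, h3, h4]
      exact ⟨(memL _ _ hqL).add_left r, (memR _ _ hqR).add_left r'⟩
    · obtain ⟨c₁, c₂, c₁', c₂', rfl, h1, h2, h3, h4⟩ := hp
      rw [hiff]
      simp only [Multiset.insert_eq_cons, Multiset.map_cons, Multiset.map_singleton, h1, h2, h3,
        h4]
      refine ⟨refl _ _, ?_⟩
      rw [← Multiset.insert_eq_cons, Multiset.pair_comm]
      exact refl _ _
  · intro p p' hpp' hh
    rw [hiff] at hpp'
    refine (h.linked_of_linked (fun q hq => ⟨(memLuv q hq).1.1, (memLuv q hq).2⟩)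
      (fun q hq => ⟨(memRuv q hq).1.1, (memRuv q hq).2⟩) ((linkLuv _ _).2 ⟨hpp'.1, ?_⟩)
      ((linkRuv _ _).2 ⟨hpp'.2, ?_⟩)).mono ?_
    · simpa only [height_map_restrict] using hh
    · simpa only [height_map_restrict] using hh
    · rintro q (hq | hq)
      · exact Or.inl (Or.inl hq)
      · exact Or.inr hq
  · intro p p' hpp' hlt
    rw [hiff] at hpp'
    obtain ⟨r, q₁, q₂, hqL, hrL, hhL, hraiseL⟩ := Linked.exists_step_height_add_two hFL.2
      (fun _ _ hxy => ((linkL _ _).1 hxy).height_mod_two hpathL) ((linkL _ _).2 hpp'.1)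
      (by simpa only [height_map_restrict] using hlt)
    obtain ⟨r', q₃, q₄, hqR, hrR, hhR, hraiseR⟩ := Linked.exists_step_height_add_two hFR.2
      (fun _ _ hxy => ((linkR _ _).1 hxy).height_mod_two hpathR) ((linkR _ _).2 hpp'.2)
      (by simpa only [height_map_restrict] using hlt)
    rw [linkL] at hrL
    rw [linkR] at hrR
    obtain ⟨p₁, p₂, h1L, h1R, h2L, h2R, hlink⟩ := h.exists_linked_joins hqL hqR
      (memL _ _ hqL).1 (memR _ _ hqR).1 hraiseL hraiseR r r'
      (by rw [← hrL.1, ← hrR.1, Multiset.card_map, Multiset.card_map])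
      (by rw [hhL, hhR, height_restrict_eq h])
    refine ⟨p₂, ?_, ?_, ?_⟩
    · rw [hiff, h2L, h2R]
      exact ⟨hrL.trans ((memL _ _ hqL).add_left r), hrR.trans ((memR _ _ hqR).add_left r')⟩
    · have e1 := height_map_restrict L ⟨u, h.leftL⟩ ⟨v, h.rightL⟩ p₂
      have e2 := height_map_restrict L ⟨u, h.leftL⟩ ⟨v, h.rightL⟩ p
      rw [h2L, height_add] at e1
      rw [height_add] at hhL
      dsimp only at e1 e2
      omega
    -- The join starts at `p₁`, not at `p`; these have equal uv-height, so lifts and reorderings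
    -- bridge them.
    · have hfix := h.linked_of_linked (p := p) (p' := p₁)
        (fun q hq => ⟨(memLuv q hq).1.1, (memLuv q hq).2⟩)
        (fun q hq => ⟨(memRuv q hq).1.1, (memRuv q hq).2⟩)
        ((linkLuv _ _).2 ⟨h1L ▸ hrL, by rw [h1L, hhL]⟩)
        ((linkRuv _ _).2 ⟨h1R ▸ hrR, by rw [h1R, hhR]⟩)
      refine (hfix.mono ?_).trans (hlink.mono fun q hq => Or.inl (Or.inr hq))
      rintro q (hq | hq)
      · exact Or.inl (Or.inl hq)
      · exact Or.inr hq

/-- Two connected non-adjacent vertices force a minimal generator of degree at least two. -/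
theorem two_le_cutMu {W : Type*} [Finite W] {G : SimpleGraph W} {a b : W} (hab : a ≠ b)
    (hadj : ¬ G.Adj a b) (hpath : G.Reachable a b) : 2 ≤ cutMu K G := by
  classical
  have hG := exists_adj_of_reachable hab hpath
  obtain ⟨F₀, hF₀⟩ := exists_isBinomialGeneratingSet K hG
  obtain ⟨F, -, hF, hcard⟩ := hF₀.exists_subset_card_le K
  by_contra hlt
  -- Only the pair a, b distinguishes these two products: its heights are 0 and 2.
  have hE : EdgeEq G {Cut.mk ∅, Cut.mk {a, b}} {Cut.mk {a}, Cut.mk {b}} := by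
    refine ⟨rfl, fun x y hxy => ?_⟩
    have hne := hxy.ne
    have h1 : ¬ (x = a ∧ y = b) := fun h => hadj (h.1 ▸ h.2 ▸ hxy)
    have h2 : ¬ (x = b ∧ y = a) := fun h => hadj (h.1 ▸ h.2 ▸ hxy.symm)
    simp only [Multiset.insert_eq_cons, ← Multiset.cons_zero, height_cons, height_zero,
      Cut.separates_mk, Set.mem_empty_iff_false, Set.mem_insert_iff, Set.mem_singleton_iff]
    by_cases hxa : x = a <;> by_cases hxb : x = b <;> by_cases hya : y = a <;>
      by_cases hyb : y = b <;> simp_all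
  have hh := ((hF.linked_iff K hG).2 hE).preserves
    (⟨⟨height a b, height_zero a b⟩, height_add a b⟩ : Multiset (Cut W) →+ ℕ) (by
      intro p hp
      have h1 := (hF.linked_iff K hG).1 (.of_mem (show (p.1, p.2) ∈ F from hp))
      have h2 := h1.height_mod_two hpath
      have h3 := hcard p hp
      have h4 := height_le_card a b p.1
      have h5 := height_le_card a b p.2
      have h6 := h1.1
      change height a b p.1 = height a b p.2
      omega)
  replace hh : height a b {Cut.mk ∅, Cut.mk {a, b}} = height a b {Cut.mk {a}, Cut.mk {b}} := hh
  simp [Multiset.insert_eq_cons, ← Multiset.cons_zero, height_cons, height_zero,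
    Cut.separates_mk, hab, hab.symm] at hh

end Generation

/-! ### The degree bound and the generating set -/

theorem mainTheorem2 {V : Type*} [Finite V] (K : Type*) [Field K] (G : SimpleGraph V)
    (u v : V) (huv : u ≠ v) (hadj : ¬ G.Adj u v) (L R : Set V)
    (huL : u ∈ L) (hvL : v ∈ L) (huR : u ∈ R) (hvR : v ∈ R)
    (hunion : L ∪ R = Set.univ) (hinter : L ∩ R = {u, v})
    (hedges : ∀ a b, G.Adj a b → (a ∈ L ∧ b ∈ L) ∨ (a ∈ R ∧ b ∈ R))
    (hpathL : (G.induce L).Reachable ⟨u, huL⟩ ⟨v, hvL⟩)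
    (hpathR : (G.induce R).Reachable ⟨u, huR⟩ ⟨v, hvR⟩)
    (hslowL : ∃ FL, IsSlowVarying K (G.induce L) ⟨u, huL⟩ ⟨v, hvL⟩ FL)
    (hslowR : ∃ FR, IsSlowVarying K (G.induce R) ⟨u, huR⟩ ⟨v, hvR⟩ FR) :
    cutMu K G ≤
        max (max (2 * cutMu K (G.induce L) - 2) (2 * cutMu K (G.induce R) - 2))
          (max (cutMu K (G.induce L ⊔ SimpleGraph.edge ⟨u, huL⟩ ⟨v, hvL⟩))
            (cutMu K (G.induce R ⊔ SimpleGraph.edge ⟨u, huR⟩ ⟨v, hvR⟩))) ∧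
      ∀ FL FR FLuv FRuv,
        IsSlowVarying K (G.induce L) ⟨u, huL⟩ ⟨v, hvL⟩ FL →
        IsSlowVarying K (G.induce R) ⟨u, huR⟩ ⟨v, hvR⟩ FR →
        IsBinomialGeneratingSet K (G.induce L ⊔ SimpleGraph.edge ⟨u, huL⟩ ⟨v, hvL⟩) FLuv →
        IsBinomialGeneratingSet K (G.induce R ⊔ SimpleGraph.edge ⟨u, huR⟩ ⟨v, hvR⟩) FRuv →
        Ideal.span (cutBinomial K ''
          (lifts L R FLuv ∪ lifts R L FRuv ∪
            joins L R ⟨u, huL⟩ ⟨v, hvL⟩ ⟨u, huR⟩ ⟨v, hvR⟩ FL FR ∪ reorderings L R)) =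
          cutIdeal K G := by
  have h : IsTwoSeparation u v L R := ⟨huv, huL, hvL, huR, hvR, hunion, hinter⟩
  refine ⟨?_, fun FL FR FLuv FRuv hFL hFR hFLuv hFRuv =>
    (h.isBinomialGeneratingSet K hedges hpathL hpathR hFL hFR hFLuv hFRuv).2⟩
  have hneL : (⟨u, huL⟩ : L) ≠ ⟨v, hvL⟩ := fun h' => huv (congrArg Subtype.val h')
  obtain ⟨FL₀, hFL₀⟩ := hslowL
  obtain ⟨FR₀, hFR₀⟩ := hslowR
  -- Low degree is achieved inside the given slow-varying sets, so slow variation is inherited.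
  obtain ⟨FL, hsubL, hFL, hdegL⟩ := hFL₀.1.exists_subset_card_le K
  obtain ⟨FR, hsubR, hFR, hdegR⟩ := hFR₀.1.exists_subset_card_le K
  have hGL := exists_adj_of_reachable hneL hpathL
  have hGR := exists_adj_of_reachable (fun h' => huv (congrArg Subtype.val h')) hpathR
  obtain ⟨FLuv₀, hFLuv₀⟩ := exists_isBinomialGeneratingSet K
    (G := G.induce L ⊔ SimpleGraph.edge ⟨u, huL⟩ ⟨v, hvL⟩)
    (hGL.imp fun _ => Exists.imp fun _ => Or.inl)
  obtain ⟨FRuv₀, hFRuv₀⟩ := exists_isBinomialGeneratingSet K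
    (G := G.induce R ⊔ SimpleGraph.edge ⟨u, huR⟩ ⟨v, hvR⟩)
    (hGR.imp fun _ => Exists.imp fun _ => Or.inl)
  obtain ⟨FLuv, -, hFLuv, hdegLuv⟩ := hFLuv₀.exists_subset_card_le K
  obtain ⟨FRuv, -, hFRuv, hdegRuv⟩ := hFRuv₀.exists_subset_card_le K
  have hgen := h.isBinomialGeneratingSet K hedges hpathL hpathR
    ⟨hFL, fun p hp => hFL₀.2 p (hsubL hp)⟩ ⟨hFR, fun p hp => hFR₀.2 p (hsubR hp)⟩ hFLuv hFRuv
  refine hgen.cutMu_le K ?_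
  rintro p (((hp | hp) | hp) | hp)
  · have := hdegLuv _ hp.1
    rw [Multiset.card_map] at this
    exact this.trans ((le_max_left _ _).trans (le_max_right _ _))
  · have := hdegRuv _ hp.1
    rw [Multiset.card_map] at this
    exact this.trans ((le_max_right _ _).trans (le_max_right _ _))
  · obtain ⟨q₁, q₂, r, q₃, q₄, r', hqL, hqR, -, -, -, -, -, -, hdeg⟩ := hp
    have h1 : Multiset.card q₁ ≤ cutMu K (G.induce L) := by
      rcases hqL with hq | hq
      · exact hdegL _ hq
      · exact (hFL.1 _ hq).symm.trans_le (hdegL _ hq)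
    have h2 : Multiset.card q₃ ≤ cutMu K (G.induce R) := by
      rcases hqR with hq | hq
      · exact hdegR _ hq
      · exact (hFR.1 _ hq).symm.trans_le (hdegR _ hq)
    -- A join has degree at most μ(G[L]) + μ(G[R]) - 2, and the larger summand can be doubled.
    refine le_trans ?_ (le_max_left _ _)
    rw [le_max_iff]
    omega
  · obtain ⟨c₁, c₂, c₁', c₂', rfl, -⟩ := hp
    have h1 : 2 ≤ cutMu K (G.induce L) := two_le_cutMu K hneL hadj hpathL
    refine le_trans ?_ ((le_max_left _ _).trans (le_max_left _ _))
    simp only [Multiset.insert_eq_cons, Multiset.card_cons, Multiset.card_singleton]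
    omega
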